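/- Let $E$ be a finite non-empty set and $X=E^{\mathbb Z}$ with its product $\sigma$-algebra. An interaction $\Phi=\{\Phi_V\}$ is a family of functions $\Phi_V:X\to\mathbb R$, indexed by the finite sets $V\Subset\mathbb Z$, such that $\Phi_V(\sigma)$ depends only on $\sigma_V$. It is uniformly absolutely convergent (UAC) if $\sup_{i}\sum_{V\ni i}\|\Phi_V\|_\infty<\infty$. Put $H^\Phi_\Lambda=\sum_{V\cap\Lambda\ne\emptyset}\Phi_V$ and $$\gamma^\Phi_\Lambda(\omega_\Lambda|\eta_{\Lambda^c})=\frac{e^{-H^\Phi_\Lambda(\omega_\Lambda\eta_{\Lambda^c})}}{\sum_{\xi_\Lambda\in E^\Lambda}e^{-H^\Phi_\Lambda(\xi_\Lambda\eta_{\Lambda^c})}},\qquad (\gamma^\Phi_\Lambda f)(\sigma)=\sum_{\xi_\Lambda\in E^\Lambda}\gamma^\Phi_\Lambda(\xi_\Lambda|\sigma_{\Lambda^c})f(\xi_\Lambda\sigma_{\Lambda^c}).$$ The set $\mathscr G(\Phi)$ of Gibbs measures consists of the probability measures $\mu$ on $X$ with $\int\gamma^\Phi_\Lambda f\,d\mu=\int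 f\,d\mu$ for all $\Lambda\Subset\mathbb Z$ and all $f\in L^1(\mu)$. The Dobrushin uniqueness criterion is $$\bar c(\Phi):=\tfrac12\sup_{i}\sum_{V\ni i}(|V|-1)\,\delta(\Phi_V)<1,\qquad \delta(f)=\sup_{\xi,\eta}|f(\xi)-f(\eta)|.$$ **Theorem.** Let $\Phi$ be a UAC interaction with $\bar c(\Phi)<1$. Let $\Lambda_1,\Lambda_2,\dots$ be any enumeration without repetition of the finite sets $V\Subset\mathbb Z$ with $\min V<0\le\max V$, and for $k\ge0$ let $\Psi^{(k)}$ be the interaction with $\Psi^{(k)}_V=0$ if $V=\Lambda_i$ for some $i\ge k+1$, and $\Psi^{(k)}_V=\Phi_V$ otherwise. Then for every $k\ge 0$, $\bar c(\Psi^{(k)})<1$, there is exactly one Gibbs measure $\nu^{(k)}$ for $\Psi^{(k)}$, the measures $\nu^{(k)}$ and $\nu^{(0)}$ are mutually absolutely continuous, and $$\frac{d\nu^{(k)}}{d\nu^{(0)}}=\frac{e^{-\sum_{i=1}^k\Phi_{\Lambda_i}}}{\int_X e^{-\sum_{i=1}^k\Phi_{\Lambda_i}}\,d\nu^{(0)}},\qquad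 \frac{d\nu^{(0)}}{d\nu^{(k)}}=\frac{e^{\sum_{i=1}^k\Phi_{\Lambda_i}}}{\int_X e^{\sum_{i=1}^k\Phi_{\Lambda_i}}\,d\nu^{(k)}}.$$ **Lemma.** Let $\Psi$ be a UAC interaction with exactly one Gibbs measure $\nu$. Let $A\Subset\mathbb Z$ and let $\mathfrak P$ be an interaction supported on $A$, that is, $\mathfrak P_V=0$ unless $V\subset A$. If $\bar\nu\in\mathscr G(\Psi+\mathfrak P)$, then $\bar\nu\ll\nu$ and $$\frac{d\bar\nu}{d\nu}=\frac{e^{-H^{\mathfrak P}_A}}{\int_X e^{-H^{\mathfrak P}_A}\,d\nu}.$$ -/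

import Mathlib

open MeasureTheory
open scoped ENNReal

noncomputable section

/-- An interaction on `E ^ L`: a family of functions indexed by the finite subsets `V` of the
lattice `L`, the function `Φ V` depending only on the spins in `V`. -/
structure LatticeInteraction (L E : Type*) where
  toFun : Finset L → (L → E) → ℝ
  dependsOn_toFun : ∀ V : Finset L, DependsOn (toFun V) (V : Set L)

namespace LatticeInteraction

variable {L E : Type*}

instance : CoeFun (LatticeInteraction L E) (fun _ => Finset L → (L → E) → ℝ) := ⟨toFun⟩

instance : Add (LatticeInteraction L E) where
  add Φ Ψ :=
    { toFun := fun V ω => Φ V ω + Ψ V ω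
      dependsOn_toFun := fun V _ _ h => by
        simp only [Φ.dependsOn_toFun V h, Ψ.dependsOn_toFun V h] }

/-- The supremum norm of a function, as an extended nonnegative real. -/
def supNorm (f : (L → E) → ℝ) : ℝ≥0∞ := ⨆ ω, ‖f ω‖ₑ

/-- The variation `δ(f) = sup {|f ξ - f η|}` of a function, as an extended nonnegative real. -/
def variation (f : (L → E) → ℝ) : ℝ≥0∞ := ⨆ (ξ) (η), ‖f ξ - f η‖ₑ

/-- Uniform absolute convergence: `sup_i ∑_{V ∋ i} ‖Φ_V‖_∞ < ∞`. -/
def IsUAC (Φ : LatticeInteraction L E) : Prop :=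
  (⨆ i : L, ∑' V : {V : Finset L // i ∈ V}, supNorm (Φ V)) < ∞

/-- The number `c̄(Φ) = (1/2) sup_i ∑_{V ∋ i} (|V| - 1) δ(Φ_V)`. -/
def dobrushinConst (Φ : LatticeInteraction L E) : ℝ≥0∞ :=
  (1 / 2) * ⨆ i : L, ∑' V : {V : Finset L // i ∈ V},
    (((V : Finset L).card : ℝ≥0∞) - 1) * variation (Φ V)

/-- Dobrushin's uniqueness criterion for interactions, `c̄(Φ) < 1`. -/
def DobrushinCriterion (Φ : LatticeInteraction L E) : Prop :=
  Φ.dobrushinConst < 1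

/-- The Hamiltonian in the volume `Λ`: `H_Λ(ω) = ∑_{V ∩ Λ ≠ ∅} Φ_V(ω)`. -/
def hamiltonian (Φ : LatticeInteraction L E) (Λ : Finset L) (ω : L → E) : ℝ :=
  ∑' V : {V : Finset L // ∃ i ∈ V, i ∈ Λ}, Φ V ω

variable [DecidableEq L] [Fintype E]

/-- The partition function `Z_Λ(η)`. Here `Function.updateFinset η Λ ξ` is the configuration
equal to `ξ` on `Λ` and to `η` off `Λ`. -/
def partitionFunction (Φ : LatticeInteraction L E) (Λ : Finset L) (η : L → E) : ℝ :=
  ∑ ξ : Λ → E, Real.exp (-Φ.hamiltonian Λ (Function.updateFinset η Λ ξ))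

/-- The specification density `γ_Λ(ξ | η)`, with `ξ` a configuration in `Λ` and `η` the
boundary condition. -/
def specDensity (Φ : LatticeInteraction L E) (Λ : Finset L) (ξ : Λ → E) (η : L → E) : ℝ :=
  Real.exp (-Φ.hamiltonian Λ (Function.updateFinset η Λ ξ)) / Φ.partitionFunction Λ η

/-- The action of the specification on functions,
`(γ_Λ f)(σ) = ∑_ξ γ_Λ(ξ | σ) f(ξ σ)`. -/
def specAverage (Φ : LatticeInteraction L E) (Λ : Finset L) (f : (L → E) → ℝ) (σ : L → E) : ℝ :=
  ∑ ξ : Λ → E, Φ.specDensity Λ ξ σ * f (Function.updateFinset σ Λ ξ)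

/-- The set of Gibbs measures of `Φ`: the probability measures on `E ^ L` satisfying the DLR
equations `∫ γ_Λ f dμ = ∫ f dμ` for every finite `Λ` and every `μ`-integrable `f`. -/
def gibbsMeasures [MeasurableSpace E] (Φ : LatticeInteraction L E) : Set (Measure (L → E)) :=
  {μ | IsProbabilityMeasure μ ∧ ∀ (Λ : Finset L) (f : (L → E) → ℝ), Integrable f μ →
    Integrable (Φ.specAverage Λ f) μ ∧ ∫ σ, Φ.specAverage Λ f σ ∂μ = ∫ σ, f σ ∂μ}

end LatticeInteraction

/-- The finite subsets of `ℤ` meeting both the negative and the nonnegative half-line, that is,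
with `min V < 0` and `max V ≥ 0`. -/
def crossOriginBonds : Set (Finset ℤ) :=
  {V | (∃ i ∈ V, i < 0) ∧ ∃ j ∈ V, 0 ≤ j}

open Classical in
/-- The intermediate interaction `Ψ^(k)`: the bonds `Λ_i` with `i ≥ k + 1` are removed from `Φ`. -/
def intermediateInteraction {E : Type*} (Φ : LatticeInteraction ℤ E) (Λ : ℕ → Finset ℤ) (k : ℕ) :
    LatticeInteraction ℤ E where
  toFun V ω := if ∃ i, k + 1 ≤ i ∧ Λ i = V then 0 else Φ V ω
  dependsOn_toFun V ξ η h := by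
    simp only [Φ.dependsOn_toFun V h]

end

/-!
If `h` is a continuous version of the total energy of `P`, then multiplying by `exp h` turns the
Boltzmann weights of `Ψ + P` into those of `Ψ`, up to a factor not depending on the spins being
resampled. Hence tilting a Gibbs measure of `Ψ + P` by `h` gives a Gibbs measure of `Ψ`, and when
the latter is unique the densities can be read off in both directions. For a finite set of added
bonds `h` is the sum of their energies, and for a perturbation supported on `A` it is `H_A`.

Gibbs measures exist by compactness of `E ^ L`. They are unique under `c̄ < 1` by Dobrushin's
comparison method: if `|∫ f dμ - ∫ f dν| ≤ ∑ j, w j * osc_j f` for two Gibbs measures and every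
continuous `f`, then applying this to the average of `f` over the spin at `i` shows that `w i` may
be replaced by `c̄ * sup w`. Doing so at all sites, and repeating, drives the weights to zero. The
constant `1 / 2` in `c̄` comes from the derivative of a finite Gibbs average with respect to the
energy: it is a covariance, and a covariance is at most a quarter of the product of the two
oscillations.
-/

noncomputable section

open Filter ProbabilityTheory Topology

namespace LatticeInteraction

section Energy

variable {L E : Type*} {Φ Ψ P : LatticeInteraction L E}

@[ext]
theorem ext (h : ∀ V ω, Φ V ω = Ψ V ω) : Φ = Ψ := by
  cases Φ
  cases Ψ
  congr
  exact funext₂ h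

theorem enorm_le_supNorm (f : (L → E) → ℝ) (ω : L → E) : ‖f ω‖ₑ ≤ supNorm f :=
  le_iSup (fun ω => ‖f ω‖ₑ) ω

theorem enorm_sub_le_variation (f : (L → E) → ℝ) (ξ η : L → E) : ‖f ξ - f η‖ₑ ≤ variation f :=
  le_iSup₂ (f := fun ξ η => ‖f ξ - f η‖ₑ) ξ η

theorem variation_le_two_mul_supNorm (f : (L → E) → ℝ) : variation f ≤ 2 * supNorm f :=
  iSup₂_le fun ξ η => calc
    ‖f ξ - f η‖ₑ ≤ ‖f ξ‖ₑ + ‖f η‖ₑ := enorm_sub_le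
    _ ≤ supNorm f + supNorm f := add_le_add (enorm_le_supNorm f ξ) (enorm_le_supNorm f η)
    _ = 2 * supNorm f := (two_mul _).symm

theorem tsum_supNorm_meeting_le (Φ : LatticeInteraction L E) (Λ : Finset L) :
    ∑' V : {V : Finset L // ∃ i ∈ V, i ∈ Λ}, supNorm (Φ V)
      ≤ ∑ i ∈ Λ, ∑' V : {V : Finset L // i ∈ V}, supNorm (Φ V) := by
  have hcover : (⋃ i ∈ Λ, {V : Finset L | i ∈ V}) = {V : Finset L | ∃ i ∈ V, i ∈ Λ} := by
    ext V; simp [and_comm]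
  have hle := ENNReal.tsum_biUnion_le (fun V : Finset L => supNorm (Φ V)) Λ fun i => {V | i ∈ V}
  rwa [hcover] at hle

theorem IsUAC.tsum_supNorm_meeting_ne_top (h : Φ.IsUAC) (Λ : Finset L) :
    ∑' V : {V : Finset L // ∃ i ∈ V, i ∈ Λ}, supNorm (Φ V) ≠ ∞ :=
  ((tsum_supNorm_meeting_le Φ Λ).trans_lt <| ENNReal.sum_lt_top.2 fun i _ =>
    (le_iSup (fun i : L => ∑' V : {V : Finset L // i ∈ V}, supNorm (Φ V)) i).trans_lt h).ne

theorem IsUAC.summable_supNorm (h : Φ.IsUAC) (Λ : Finset L) :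
    Summable fun V : {V : Finset L // ∃ i ∈ V, i ∈ Λ} => (supNorm (Φ V)).toReal :=
  ENNReal.summable_toReal (h.tsum_supNorm_meeting_ne_top Λ)

theorem IsUAC.norm_le_supNorm (h : Φ.IsUAC) {Λ : Finset L}
    (V : {V : Finset L // ∃ i ∈ V, i ∈ Λ}) (ω : L → E) : ‖Φ V ω‖ ≤ (supNorm (Φ V)).toReal := by
  rw [← toReal_enorm]
  exact ENNReal.toReal_mono (ENNReal.ne_top_of_tsum_ne_top (h.tsum_supNorm_meeting_ne_top Λ) V)
    (enorm_le_supNorm (Φ V) ω)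

theorem IsUAC.summable (h : Φ.IsUAC) (Λ : Finset L) (ω : L → E) :
    Summable fun V : {V : Finset L // ∃ i ∈ V, i ∈ Λ} => Φ V ω :=
  .of_norm_bounded (h.summable_supNorm Λ) fun V => h.norm_le_supNorm V ω

theorem IsUAC.hamiltonian_add (hΨ : Ψ.IsUAC) (hP : P.IsUAC) (Λ : Finset L) (ω : L → E) :
    (Ψ + P).hamiltonian Λ ω = Ψ.hamiltonian Λ ω + P.hamiltonian Λ ω :=
  (hΨ.summable Λ ω).tsum_add (hP.summable Λ ω)

theorem IsUAC.mono (h : Φ.IsUAC) (hle : ∀ V, supNorm (Ψ V) ≤ supNorm (Φ V)) : Ψ.IsUAC :=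
  lt_of_le_of_lt (iSup_mono fun _ => ENNReal.tsum_le_tsum fun V => hle V) h

theorem DobrushinCriterion.mono (h : Φ.DobrushinCriterion)
    (hle : ∀ V, variation (Ψ V) ≤ variation (Φ V)) : Ψ.DobrushinCriterion := by
  refine lt_of_le_of_lt ?_ h
  unfold dobrushinConst
  gcongr
  exact hle _

/-- `h` is a version of the formal total energy `∑_V P_V`, which need not converge: `h` changes by
as much as `H_Λ` does whenever only the spins in the finite set `Λ` are changed. -/
def IsTotalEnergy (P : LatticeInteraction L E) (h : (L → E) → ℝ) : Prop :=
  ∀ Λ : Finset L, DependsOn (fun ω => h ω - P.hamiltonian Λ ω) (Λ : Set L)ᶜ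

theorem IsUAC.dependsOn_sub_hamiltonian (hΦ : Φ.IsUAC) {S : Set (Finset L)} {h : (L → E) → ℝ}
    (hS : ∀ ω, HasSum (fun V : S => Φ V ω) (h ω)) {Λ : Finset L}
    (hΛ : ∀ V : Finset L, (∃ i ∈ V, i ∈ Λ) → V ∈ S ∨ ∀ ω, Φ V ω = 0) :
    DependsOn (fun ω => h ω - Φ.hamiltonian Λ ω) (Λ : Set L)ᶜ := by
  classical
  intro σ τ hστ
  let T : Set (Finset L) := {V | ∃ i ∈ V, i ∈ Λ}
  let diff (ω : L → E) (V : Finset L) : ℝ :=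
    S.indicator (fun V => Φ V ω) V - T.indicator (fun V => Φ V ω) V
  have hasSum_diff (ω : L → E) : HasSum (diff ω) (h ω - Φ.hamiltonian Λ ω) :=
    (hasSum_subtype_iff_indicator.1 (hS ω)).sub
      (hasSum_subtype_iff_indicator.1 (hΦ.summable Λ ω).hasSum)
  have diff_congr : diff σ = diff τ := funext fun V => by
    by_cases hV : V ∈ T
    · rcases hΛ V hV with hVS | h0
      · simp only [diff, Set.indicator_of_mem hV, Set.indicator_of_mem hVS, sub_self]
      · simp only [diff, Set.indicator_apply, h0, ite_self, sub_self]
    · have : Φ V σ = Φ V τ := Φ.dependsOn_toFun V fun i hi => hστ i fun hiΛ => hV ⟨i, hi, hiΛ⟩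
      simp only [diff, Set.indicator_apply, this]
  exact (diff_congr ▸ hasSum_diff σ).unique (hasSum_diff τ)

theorem IsUAC.dependsOn_hamiltonian_sub (h : Φ.IsUAC) {Λ Δ : Finset L} (hΛΔ : Λ ⊆ Δ) :
    DependsOn (fun ω => Φ.hamiltonian Δ ω - Φ.hamiltonian Λ ω) (Λ : Set L)ᶜ :=
  h.dependsOn_sub_hamiltonian (S := {V | ∃ i ∈ V, i ∈ Δ}) (fun ω => (h.summable Δ ω).hasSum)
    fun _ ⟨i, hiV, hiΛ⟩ => .inl ⟨i, hiV, hΛΔ hiΛ⟩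

theorem IsUAC.isTotalEnergy_hamiltonian (h : P.IsUAC) {A : Finset L}
    (hA : ∀ V : Finset L, V.Nonempty → Disjoint V A → ∀ ω, P V ω = 0) :
    P.IsTotalEnergy (P.hamiltonian A) := fun _ =>
  h.dependsOn_sub_hamiltonian (S := {V | ∃ i ∈ V, i ∈ A}) (fun ω => (h.summable A ω).hasSum)
    fun V ⟨i, hiV, _⟩ => (em _).imp_right fun hVA => hA V ⟨i, hiV⟩ <|
      Finset.disjoint_left.2 fun j hjV hjA => hVA ⟨j, hjV, hjA⟩

end Energy

section DeleteBonds

variable {L E : Type*} {Φ : LatticeInteraction L E}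

open Classical in
/-- The interaction `Φ` with the bonds in `S` removed, that is, set to zero. -/
def deleteBonds (Φ : LatticeInteraction L E) (S : Set (Finset L)) : LatticeInteraction L E where
  toFun V ω := if V ∈ S then 0 else Φ V ω
  dependsOn_toFun V ξ η h := by simp only [Φ.dependsOn_toFun V h]

open Classical in
theorem deleteBonds_apply (Φ : LatticeInteraction L E) (S : Set (Finset L)) (V : Finset L)
    (ω : L → E) : Φ.deleteBonds S V ω = if V ∈ S then 0 else Φ V ω := rfl

theorem IsUAC.deleteBonds (h : Φ.IsUAC) (S : Set (Finset L)) : (Φ.deleteBonds S).IsUAC :=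
  h.mono fun V => iSup_mono fun ω => by
    rw [deleteBonds_apply]
    split_ifs <;> simp

theorem DobrushinCriterion.deleteBonds (h : Φ.DobrushinCriterion) (S : Set (Finset L)) :
    (Φ.deleteBonds S).DobrushinCriterion :=
  h.mono fun V => iSup₂_mono fun ξ η => by
    rw [deleteBonds_apply, deleteBonds_apply]
    split_ifs <;> simp

theorem deleteBonds_union_add_deleteBonds_compl {S F : Set (Finset L)} (hSF : Disjoint S F) :
    Φ.deleteBonds (S ∪ F) + Φ.deleteBonds Fᶜ = Φ.deleteBonds S := by
  ext V ω
  have hV : V ∈ F → V ∉ S := fun hF hS => hSF.notMem_of_mem_left hS hF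
  change Φ.deleteBonds (S ∪ F) V ω + Φ.deleteBonds Fᶜ V ω = Φ.deleteBonds S V ω
  by_cases hS : V ∈ S <;> by_cases hF : V ∈ F <;> simp_all [deleteBonds_apply]

theorem IsUAC.isTotalEnergy_deleteBonds_compl (h : Φ.IsUAC) (F : Finset (Finset L)) :
    (Φ.deleteBonds (F : Set (Finset L))ᶜ).IsTotalEnergy fun ω => ∑ V ∈ F, Φ V ω := fun _ =>
  (h.deleteBonds _).dependsOn_sub_hamiltonian (S := F)
    (fun ω => by
      simpa [deleteBonds_apply, Function.comp_def] using F.hasSum fun V => Φ V ω)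
    fun V _ => (em _).imp_right fun hV ω => by simp [deleteBonds_apply, hV]

end DeleteBonds

section Continuity

variable {L E : Type*} [TopologicalSpace E] [DiscreteTopology E] {Φ : LatticeInteraction L E}

theorem continuous_toFun (Φ : LatticeInteraction L E) (V : Finset L) : Continuous (Φ V) := by
  obtain ⟨g, hg⟩ := dependsOn_iff_exists_comp.1 (Φ.dependsOn_toFun V)
  rw [hg]
  exact (continuous_of_discreteTopology (f := g)).comp
    (continuous_pi fun i => continuous_apply (i : L))

theorem IsUAC.continuous_hamiltonian (h : Φ.IsUAC) (Λ : Finset L) :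
    Continuous (Φ.hamiltonian Λ) :=
  continuous_tsum (fun V => Φ.continuous_toFun V) (h.summable_supNorm Λ) h.norm_le_supNorm

theorem supNorm_ne_top_of_continuous {L E : Type*} [TopologicalSpace E] [Finite E]
    {f : (L → E) → ℝ} (hf : Continuous f) : supNorm f ≠ ∞ := by
  obtain ⟨C, hC⟩ := isCompact_univ.exists_bound_of_continuousOn hf.continuousOn
  exact ne_top_of_le_ne_top ENNReal.coe_ne_top <| iSup_le fun ω =>
    enorm_le_coe.2 <| NNReal.coe_le_coe.1 <| (hC ω trivial).trans (Real.le_coe_toNNReal C)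

end Continuity

theorem isUAC_of_eq_zero_of_not_subset {L E : Type*} [Finite E] {Φ : LatticeInteraction L E}
    {A : Finset L} (hA : ∀ V : Finset L, ¬ V ⊆ A → ∀ ω, Φ V ω = 0) : Φ.IsUAC := by
  let : TopologicalSpace E := ⊥
  have : DiscreteTopology E := ⟨rfl⟩
  have hzero (V : Finset L) (hV : V ∉ A.powerset) : supNorm (Φ V) = 0 := by
    simp [supNorm, hA V (mt Finset.mem_powerset.2 hV)]
  refine lt_of_le_of_lt (iSup_le fun i => ?_) <| ENNReal.sum_lt_top.2 fun V (_ : V ∈ A.powerset) =>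
    (supNorm_ne_top_of_continuous (Φ.continuous_toFun V)).lt_top
  calc ∑' V : {V : Finset L // i ∈ V}, supNorm (Φ V) ≤ ∑' V : Finset L, supNorm (Φ V) :=
        ENNReal.tsum_comp_le_tsum_of_injective Subtype.val_injective fun V => supNorm (Φ V)
    _ = ∑ V ∈ A.powerset, supNorm (Φ V) := tsum_eq_sum hzero

section Specification

variable {L E : Type*} [DecidableEq L] [Fintype E]

/-- The sum of `F` over all spin configurations in `Λ`, the spins outside `Λ` being kept. -/
def siteSum (Λ : Finset L) (F : (L → E) → ℝ) (σ : L → E) : ℝ :=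
  ∑ ξ : Λ → E, F (Function.updateFinset σ Λ ξ)

theorem siteSum_union {s t : Finset L} (hst : Disjoint s t) (F : (L → E) → ℝ) (σ : L → E) :
    siteSum (s ∪ t) F σ = siteSum s (siteSum t F) σ := by
  simp only [siteSum, Function.updateFinset_updateFinset hst]
  rw [← Fintype.sum_prod_type', ← (Equiv.piFinsetUnion (fun _ => E) hst).sum_comp]

theorem dependsOn_siteSum (Λ : Finset L) (F : (L → E) → ℝ) :
    DependsOn (siteSum Λ F) (Λ : Set L)ᶜ := fun _ _ hστ =>
  Finset.sum_congr rfl fun ξ _ =>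
    ((dependsOn_univ F).updateFinset ξ) fun i hi => hστ i hi.2

theorem siteSum_mul_of_dependsOn {Λ : Finset L} (F : (L → E) → ℝ) {G : (L → E) → ℝ}
    (hG : DependsOn G (Λ : Set L)ᶜ) (σ : L → E) :
    siteSum Λ (fun ω => F ω * G ω) σ = siteSum Λ F σ * G σ := by
  have hG' (ξ : Λ → E) : G (Function.updateFinset σ Λ ξ) = G σ :=
    hG fun i hi => dif_neg hi
  simp only [siteSum, hG', Finset.sum_mul]

theorem siteSum_exp_pos [Nonempty E] (Λ : Finset L) (F : (L → E) → ℝ) (σ : L → E) :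
    0 < siteSum Λ (fun ω => Real.exp (F ω)) σ :=
  Finset.sum_pos (fun _ _ => Real.exp_pos _) Finset.univ_nonempty

theorem specAverage_eq_div (Φ : LatticeInteraction L E) (Λ : Finset L) (f : (L → E) → ℝ)
    (σ : L → E) : Φ.specAverage Λ f σ
      = siteSum Λ (fun ω => Real.exp (-Φ.hamiltonian Λ ω) * f ω) σ
        / siteSum Λ (fun ω => Real.exp (-Φ.hamiltonian Λ ω)) σ := by
  simp only [specAverage, specDensity, partitionFunction, siteSum, Finset.sum_div,
    div_mul_eq_mul_div]

theorem dependsOn_specAverage (Φ : LatticeInteraction L E) (Λ : Finset L) (f : (L → E) → ℝ) :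
    DependsOn (Φ.specAverage Λ f) (Λ : Set L)ᶜ := fun _ _ h => by
  rw [specAverage_eq_div, specAverage_eq_div, dependsOn_siteSum Λ _ h, dependsOn_siteSum Λ _ h]

theorem siteSum_mul_specAverage [Nonempty E] (Φ : LatticeInteraction L E) (Λ : Finset L)
    (f : (L → E) → ℝ) {g : (L → E) → ℝ}
    (hg : DependsOn (fun ω => g ω + Φ.hamiltonian Λ ω) (Λ : Set L)ᶜ) (σ : L → E) :
    siteSum Λ (fun ω => Real.exp (g ω) * Φ.specAverage Λ f ω) σ
      = siteSum Λ (fun ω => Real.exp (g ω) * f ω) σ := by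
  let w (ω : L → E) : ℝ := Real.exp (-Φ.hamiltonian Λ ω)
  let G (ω : L → E) : ℝ := Real.exp (g ω + Φ.hamiltonian Λ ω)
  have hG : DependsOn G (Λ : Set L)ᶜ := fun _ _ h => congrArg Real.exp (hg h)
  have hfactor (ω : L → E) : Real.exp (g ω) = w ω * G ω := by
    rw [← Real.exp_add]; ring_nf
  calc siteSum Λ (fun ω => Real.exp (g ω) * Φ.specAverage Λ f ω) σ
      = siteSum Λ (fun ω => w ω * G ω * Φ.specAverage Λ f ω) σ := by simp only [hfactor]
    _ = siteSum Λ w σ * G σ * Φ.specAverage Λ f σ := by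
        rw [siteSum_mul_of_dependsOn _ (Φ.dependsOn_specAverage Λ f), siteSum_mul_of_dependsOn _ hG]
    _ = siteSum Λ (fun ω => w ω * f ω) σ * G σ := by
        rw [specAverage_eq_div, mul_right_comm,
          mul_div_cancel₀ _ (siteSum_exp_pos Λ _ σ).ne']
    _ = siteSum Λ (fun ω => Real.exp (g ω) * f ω) σ := by
        rw [← siteSum_mul_of_dependsOn _ hG]
        simp only [hfactor, mul_right_comm]

theorem specAverage_exp_mul_specAverage [Nonempty E] {Φ Ψ : LatticeInteraction L E}
    {Λ Δ : Finset L} (hΛΔ : Λ ⊆ Δ) {h : (L → E) → ℝ}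
    (hdep : DependsOn (fun ω => h ω - Φ.hamiltonian Δ ω + Ψ.hamiltonian Λ ω) (Λ : Set L)ᶜ)
    (f : (L → E) → ℝ) (σ : L → E) :
    Φ.specAverage Δ (fun ω => Real.exp (h ω) * Ψ.specAverage Λ f ω) σ
      = Φ.specAverage Δ (fun ω => Real.exp (h ω) * f ω) σ := by
  rw [specAverage_eq_div, specAverage_eq_div, ← Finset.sdiff_union_of_subset hΛΔ]
  simp only [siteSum_union Finset.sdiff_disjoint, ← mul_assoc, ← Real.exp_add]
  congr 2
  ext ω
  refine siteSum_mul_specAverage Ψ Λ f ?_ ω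
  rw [Finset.sdiff_union_of_subset hΛΔ]
  convert! hdep using 2
  ring

theorem IsUAC.specAverage_specAverage [Nonempty E] {Φ : LatticeInteraction L E} (h : Φ.IsUAC)
    {Λ Δ : Finset L} (hΛΔ : Λ ⊆ Δ) (f : (L → E) → ℝ) (σ : L → E) :
    Φ.specAverage Δ (Φ.specAverage Λ f) σ = Φ.specAverage Δ f σ := by
  have hdep : DependsOn (fun ω => 0 - Φ.hamiltonian Δ ω + Φ.hamiltonian Λ ω) (Λ : Set L)ᶜ := by
    intro σ τ hστ
    linarith [h.dependsOn_hamiltonian_sub hΛΔ hστ]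
  simpa using specAverage_exp_mul_specAverage hΛΔ hdep f σ

theorem specDensity_nonneg (Φ : LatticeInteraction L E) (Λ : Finset L) (ξ : Λ → E)
    (σ : L → E) : 0 ≤ Φ.specDensity Λ ξ σ :=
  div_nonneg (Real.exp_pos _).le (Finset.sum_nonneg fun _ _ => (Real.exp_pos _).le)

theorem sum_specDensity [Nonempty E] (Φ : LatticeInteraction L E) (Λ : Finset L)
    (σ : L → E) : ∑ ξ, Φ.specDensity Λ ξ σ = 1 := by
  simp only [specDensity, ← Finset.sum_div]
  exact div_self (siteSum_exp_pos Λ (fun ω => -Φ.hamiltonian Λ ω) σ).ne'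

theorem continuous_updateFinset {L E : Type*} [DecidableEq L] [TopologicalSpace E] (Λ : Finset L)
    (ξ : Λ → E) : Continuous fun σ : L → E => Function.updateFinset σ Λ ξ :=
  continuous_pi fun i => by
    by_cases hi : i ∈ Λ
    · simpa only [Function.updateFinset, hi, dite_true] using continuous_const
    · simpa only [Function.updateFinset, hi, dite_false] using continuous_apply i

theorem IsUAC.continuous_specDensity [Nonempty E] [TopologicalSpace E] [DiscreteTopology E]
    {Φ : LatticeInteraction L E} (h : Φ.IsUAC) (Λ : Finset L) (ξ : Λ → E) :
    Continuous (Φ.specDensity Λ ξ) := by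
  have hweight (ζ : Λ → E) :
      Continuous fun σ => Real.exp (-Φ.hamiltonian Λ (Function.updateFinset σ Λ ζ)) :=
    ((h.continuous_hamiltonian Λ).comp (continuous_updateFinset Λ ζ)).neg.rexp
  exact (hweight ξ).div (continuous_finsetSum _ fun ζ _ => hweight ζ)
    fun σ => (siteSum_exp_pos Λ (fun ω => -Φ.hamiltonian Λ ω) σ).ne'

theorem IsUAC.continuous_specAverage [Nonempty E] [TopologicalSpace E] [DiscreteTopology E]
    {Φ : LatticeInteraction L E} (h : Φ.IsUAC) (Λ : Finset L) {f : (L → E) → ℝ}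
    (hf : Continuous f) : Continuous (Φ.specAverage Λ f) :=
  continuous_finsetSum _ fun ξ _ =>
    (h.continuous_specDensity Λ ξ).mul (hf.comp (continuous_updateFinset Λ ξ))

end Specification

section Gibbs

variable {L E : Type*} [DecidableEq L] [Countable L] [Fintype E] [Nonempty E]
  [TopologicalSpace E] [DiscreteTopology E] [MeasurableSpace E] [BorelSpace E]
  {Φ Ψ P : LatticeInteraction L E}

theorem integrable_of_continuous {X : Type*} [TopologicalSpace X] [CompactSpace X]
    [MeasurableSpace X] [OpensMeasurableSpace X] {f : X → ℝ} (hf : Continuous f) (μ : Measure X)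
    [IsFiniteMeasure μ] : Integrable f μ :=
  (BoundedContinuousFunction.mkOfCompact ⟨f, hf⟩).integrable μ

/-- The specification `γ_Λ` as a Markov kernel. -/
def IsUAC.specKernel (h : Φ.IsUAC) (Λ : Finset L) : Kernel (L → E) (L → E) where
  toFun σ := ∑ ξ : Λ → E, ENNReal.ofReal (Φ.specDensity Λ ξ σ) •
    Measure.dirac (Function.updateFinset σ Λ ξ)
  measurable' := by
    refine Measure.measurable_of_measurable_coe _ fun s hs => ?_
    simp only [Measure.coe_finsetSum, Finset.sum_apply, Measure.smul_apply, smul_eq_mul]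
    exact Finset.measurable_fun_sum _ fun ξ _ =>
      (h.continuous_specDensity Λ ξ).measurable.ennreal_ofReal.mul <|
        (Measure.measurable_coe hs).comp <|
          Measure.measurable_dirac.comp (continuous_updateFinset Λ ξ).measurable

theorem IsUAC.specKernel_apply (h : Φ.IsUAC) (Λ : Finset L) (σ : L → E) :
    h.specKernel Λ σ = ∑ ξ : Λ → E, ENNReal.ofReal (Φ.specDensity Λ ξ σ) •
      Measure.dirac (Function.updateFinset σ Λ ξ) := rfl

instance (h : Φ.IsUAC) (Λ : Finset L) : IsMarkovKernel (h.specKernel Λ) where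
  isProbabilityMeasure σ := by
    constructor
    simp only [h.specKernel_apply, Measure.coe_finsetSum, Finset.sum_apply, Measure.smul_apply,
      measure_univ, smul_eq_mul, mul_one]
    rw [← ENNReal.ofReal_sum_of_nonneg fun ξ _ => specDensity_nonneg Φ Λ ξ σ, sum_specDensity,
      ENNReal.ofReal_one]

theorem IsUAC.integral_specKernel (h : Φ.IsUAC) (Λ : Finset L) (f : (L → E) → ℝ) (σ : L → E) :
    ∫ ω, f ω ∂(h.specKernel Λ σ) = Φ.specAverage Λ f σ := by
  rw [h.specKernel_apply, integral_finsetSum_measure fun ξ _ =>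
    (integrable_dirac enorm_lt_top).smul_measure ENNReal.ofReal_ne_top]
  simp only [integral_smul_measure, integral_dirac, smul_eq_mul, specAverage,
    ENNReal.toReal_ofReal (specDensity_nonneg Φ Λ _ σ)]

theorem IsUAC.integral_specAverage (h : Φ.IsUAC) (Λ : Finset L) {μ : Measure (L → E)}
    [SFinite μ] {f : (L → E) → ℝ} (hf : Integrable f (μ.bind (h.specKernel Λ))) :
    Integrable (Φ.specAverage Λ f) μ ∧
      ∫ σ, Φ.specAverage Λ f σ ∂μ = ∫ σ, f σ ∂(μ.bind (h.specKernel Λ)) := by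
  simp only [← funext (h.integral_specKernel Λ f)]
  rw [Measure.comp_eq_comp_const_apply] at hf ⊢
  exact ⟨hf.integral_comp, (Kernel.integral_comp hf).symm⟩

theorem IsUAC.mem_gibbsMeasures (h : Φ.IsUAC) {μ : Measure (L → E)} [IsProbabilityMeasure μ]
    (hμ : ∀ (Λ : Finset L) (f : (L → E) → ℝ), Continuous f →
      ∫ σ, Φ.specAverage Λ f σ ∂μ = ∫ σ, f σ ∂μ) : μ ∈ Φ.gibbsMeasures := by
  have invariant (Λ : Finset L) : μ.bind (h.specKernel Λ) = μ :=
    ext_of_forall_integral_eq_of_IsFiniteMeasure fun f => by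
      rw [← (h.integral_specAverage Λ (integrable_of_continuous f.continuous _)).2,
        hμ Λ f f.continuous]
  refine ⟨inferInstance, fun Λ f hf => ?_⟩
  have hDLR := h.integral_specAverage Λ (f := f) (by rwa [invariant])
  rwa [invariant] at hDLR

theorem IsUAC.gibbsMeasures_nonempty (h : Φ.IsUAC) : Φ.gibbsMeasures.Nonempty := by
  obtain ⟨σ⟩ : Nonempty (L → E) := inferInstance
  let finiteVolume (Λ : Finset L) : ProbabilityMeasure (L → E) :=
    ⟨h.specKernel Λ σ, inferInstance⟩
  let U : Ultrafilter (Finset L) := Ultrafilter.of atTop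
  obtain ⟨μ, -, hμ⟩ := isCompact_univ.ultrafilter_le_nhds (U.map finiteVolume) (by simp)
  have tendsto_specAverage {f : (L → E) → ℝ} (hf : Continuous f) :
      Tendsto (fun Δ => Φ.specAverage Δ f σ) U (𝓝 (∫ ω, f ω ∂(μ : Measure (L → E)))) :=
    (ProbabilityMeasure.tendsto_iff_forall_integral_tendsto.1 hμ
      (BoundedContinuousFunction.mkOfCompact ⟨f, hf⟩)).congr
        fun Δ => h.integral_specKernel Δ f σ
  refine ⟨μ, h.mem_gibbsMeasures fun Λ f hf => ?_⟩
  refine tendsto_nhds_unique (tendsto_specAverage (h.continuous_specAverage Λ hf))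
    ((tendsto_specAverage hf).congr' ?_)
  filter_upwards [Ultrafilter.of_le _ (mem_atTop Λ)] with Δ hΛΔ
  exact (h.specAverage_specAverage hΛΔ f σ).symm

theorem tilted_mem_gibbsMeasures (hΨ : Ψ.IsUAC) (hP : P.IsUAC) {h : (L → E) → ℝ}
    (hcont : Continuous h) (hh : P.IsTotalEnergy h) {μ : Measure (L → E)}
    (hμ : μ ∈ (Ψ + P).gibbsMeasures) : μ.tilted h ∈ Ψ.gibbsMeasures := by
  have := hμ.1
  have := isProbabilityMeasure_tilted (integrable_of_continuous hcont.rexp μ)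
  refine hΨ.mem_gibbsMeasures fun Λ f hf => ?_
  have integral_specAverage {g : (L → E) → ℝ} (hg : Continuous g) :
      ∫ σ, (Ψ + P).specAverage Λ g σ ∂μ = ∫ σ, g σ ∂μ :=
    (hμ.2 Λ g (integrable_of_continuous hg μ)).2
  have hdep : DependsOn (fun ω => h ω - (Ψ + P).hamiltonian Λ ω + Ψ.hamiltonian Λ ω)
      (Λ : Set L)ᶜ := by
    convert! hh Λ using 2 with ω
    rw [hΨ.hamiltonian_add hP]
    ring
  have key := calc
    ∫ σ, Real.exp (h σ) * Ψ.specAverage Λ f σ ∂μ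
      = ∫ σ, (Ψ + P).specAverage Λ (fun ω => Real.exp (h ω) * Ψ.specAverage Λ f ω) σ ∂μ :=
        (integral_specAverage (hcont.rexp.mul (hΨ.continuous_specAverage Λ hf))).symm
    _ = ∫ σ, (Ψ + P).specAverage Λ (fun ω => Real.exp (h ω) * f ω) σ ∂μ := by
        simp only [specAverage_exp_mul_specAverage subset_rfl hdep]
    _ = ∫ σ, Real.exp (h σ) * f σ ∂μ := integral_specAverage (hcont.rexp.mul hf)
  simp only [integral_tilted, smul_eq_mul, div_mul_eq_mul_div, integral_div, key]

theorem eq_tilted_of_gibbsMeasures_eq_singleton (hΨ : Ψ.IsUAC) (hP : P.IsUAC)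
    {h : (L → E) → ℝ} (hcont : Continuous h) (hh : P.IsTotalEnergy h) {ν ν' : Measure (L → E)}
    (hν : Ψ.gibbsMeasures = {ν}) (hν' : ν' ∈ (Ψ + P).gibbsMeasures) :
    ν = ν'.tilted h ∧ ν' = ν.tilted (-h) := by
  have := hν'.1
  have htilted : ν'.tilted h = ν :=
    Set.mem_singleton_iff.1 (hν ▸ tilted_mem_gibbsMeasures hΨ hP hcont hh hν')
  refine ⟨htilted.symm, ?_⟩
  rw [← htilted, tilted_neg_same (integrable_of_continuous hcont.rexp ν')]

end Gibbs

section GibbsAverage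

variable {ι : Type*} [Fintype ι] {p f g u v : ι → ℝ} {a b : ℝ}

theorem sum_mul_sub_mean_mul_sub_mean (hp : ∑ x, p x = 1) (f g : ι → ℝ) :
    ∑ x, p x * ((f x - ∑ y, p y * f y) * (g x - ∑ y, p y * g y))
      = ∑ x, p x * (f x * g x) - (∑ x, p x * f x) * ∑ x, p x * g x := by
  set m := ∑ y, p y * f y
  set n := ∑ y, p y * g y
  have hexpand (x : ι) : p x * ((f x - m) * (g x - n))
      = p x * (f x * g x) - n * (p x * f x) - m * (p x * g x) + p x * (m * n) := by ring
  simp only [hexpand, Finset.sum_add_distrib, Finset.sum_sub_distrib, ← Finset.mul_sum,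
    ← Finset.sum_mul, hp]
  ring

theorem sum_mul_sq_sub_mean_le_sum_mul_sq_sub (hp : ∑ x, p x = 1) (f : ι → ℝ) (c : ℝ) :
    ∑ x, p x * (f x - ∑ y, p y * f y) ^ 2 ≤ ∑ x, p x * (f x - c) ^ 2 := by
  set m := ∑ y, p y * f y
  have hexpand (x : ι) : p x * (f x - c) ^ 2
      = p x * (f x - m) ^ 2 + 2 * (m - c) * (p x * f x - p x * m) + p x * (m - c) ^ 2 := by ring
  have hsplit : ∑ x, p x * (f x - c) ^ 2 = ∑ x, p x * (f x - m) ^ 2 + (m - c) ^ 2 := by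
    simp only [hexpand, Finset.sum_add_distrib, Finset.sum_sub_distrib, ← Finset.mul_sum,
      ← Finset.sum_mul, hp]
    ring
  exact hsplit ▸ le_add_of_nonneg_right (sq_nonneg _)

theorem sum_mul_sq_sub_mean_le_of_abs_sub_le (hp0 : ∀ x, 0 ≤ p x) (hp : ∑ x, p x = 1)
    (hf : ∀ x y, |f x - f y| ≤ a) : ∑ x, p x * (f x - ∑ y, p y * f y) ^ 2 ≤ (a / 2) ^ 2 := by
  have : Nonempty ι := by
    by_contra! h
    simp at hp
  obtain ⟨xmax, hmax⟩ := Finite.exists_max f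
  obtain ⟨xmin, hmin⟩ := Finite.exists_min f
  let c := (f xmax + f xmin) / 2
  have hc (x : ι) : (f x - c) ^ 2 ≤ (a / 2) ^ 2 := by
    have := (abs_le.1 (hf xmax xmin)).2
    refine sq_le_sq' ?_ ?_ <;> simp only [c] <;> linarith [hmax x, hmin x]
  calc ∑ x, p x * (f x - ∑ y, p y * f y) ^ 2 ≤ ∑ x, p x * (f x - c) ^ 2 :=
        sum_mul_sq_sub_mean_le_sum_mul_sq_sub hp f c
    _ ≤ ∑ x, p x * (a / 2) ^ 2 :=
        Finset.sum_le_sum fun x _ => mul_le_mul_of_nonneg_left (hc x) (hp0 x)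
    _ = (a / 2) ^ 2 := by rw [← Finset.sum_mul, hp, one_mul]

theorem abs_weighted_covariance_le (hp0 : ∀ x, 0 ≤ p x) (hp : ∑ x, p x = 1)
    (ha : 0 ≤ a) (hb : 0 ≤ b) (hf : ∀ x y, |f x - f y| ≤ a) (hg : ∀ x y, |g x - g y| ≤ b) :
    |∑ x, p x * (f x * g x) - (∑ x, p x * f x) * ∑ x, p x * g x| ≤ a * b / 4 := by
  rw [← sum_mul_sub_mean_mul_sub_mean hp]
  refine abs_le_of_sq_le_sq ?_ (by positivity)
  calc (∑ x, p x * ((f x - ∑ y, p y * f y) * (g x - ∑ y, p y * g y))) ^ 2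
      ≤ (∑ x, p x * (f x - ∑ y, p y * f y) ^ 2) * ∑ x, p x * (g x - ∑ y, p y * g y) ^ 2 :=
        Finset.sum_sq_le_sum_mul_sum_of_sq_le_mul _
          (fun x _ => mul_nonneg (hp0 x) (sq_nonneg _))
          (fun x _ => mul_nonneg (hp0 x) (sq_nonneg _)) fun x _ => le_of_eq (by ring)
    _ ≤ (a / 2) ^ 2 * (b / 2) ^ 2 :=
        mul_le_mul (sum_mul_sq_sub_mean_le_of_abs_sub_le hp0 hp hf)
          (sum_mul_sq_sub_mean_le_of_abs_sub_le hp0 hp hg)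
          (Finset.sum_nonneg fun x _ => mul_nonneg (hp0 x) (sq_nonneg _)) (sq_nonneg _)
    _ = (a * b / 4) ^ 2 := by ring

/-- The average of `f` under the probability distribution on `ι` proportional to `exp u`. -/
def gibbsAverage (u f : ι → ℝ) : ℝ :=
  (∑ x, Real.exp (u x) * f x) / ∑ x, Real.exp (u x)

variable [Nonempty ι]

theorem sum_exp_pos (u : ι → ℝ) : 0 < ∑ x, Real.exp (u x) :=
  Finset.sum_pos (fun _ _ => Real.exp_pos _) Finset.univ_nonempty

theorem abs_gibbsAverage_mul_sub_le (u : ι → ℝ) (ha : 0 ≤ a) (hb : 0 ≤ b)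
    (hf : ∀ x y, |f x - f y| ≤ a) (hg : ∀ x y, |g x - g y| ≤ b) :
    |gibbsAverage u (fun x => f x * g x) - gibbsAverage u f * gibbsAverage u g| ≤ a * b / 4 := by
  let Z := ∑ x, Real.exp (u x)
  have hZ : 0 < Z := sum_exp_pos u
  have hcov := abs_weighted_covariance_le (p := fun x => Real.exp (u x) / Z)
    (fun x => div_nonneg (Real.exp_pos _).le hZ.le)
    (by rw [← Finset.sum_div, div_self hZ.ne']) ha hb hf hg
  simpa only [gibbsAverage, div_mul_eq_mul_div, ← Finset.sum_div] using hcov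

theorem hasDerivAt_gibbsAverage (v h f : ι → ℝ) (t : ℝ) :
    HasDerivAt (fun t => gibbsAverage (fun x => v x + t * h x) f)
      (gibbsAverage (fun x => v x + t * h x) (fun x => f x * h x)
        - gibbsAverage (fun x => v x + t * h x) f * gibbsAverage (fun x => v x + t * h x) h) t := by
  have hw (x : ι) : HasDerivAt (fun t => Real.exp (v x + t * h x))
      (Real.exp (v x + t * h x) * h x) t := by
    simpa using (((hasDerivAt_id t).mul_const (h x)).const_add (v x)).exp
  have hZ := (sum_exp_pos fun x => v x + t * h x).ne'
  convert! (HasDerivAt.fun_sum fun x _ => (hw x).mul_const (f x)).div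
    (HasDerivAt.fun_sum fun x _ => hw x) hZ using 1
  simp only [gibbsAverage, mul_right_comm _ (h _) (f _), ← mul_assoc]
  field_simp

theorem abs_gibbsAverage_sub_gibbsAverage_le (hf : ∀ x y, |f x - f y| ≤ a)
    (huv : ∀ x y, |(u x - v x) - (u y - v y)| ≤ b) :
    |gibbsAverage u f - gibbsAverage v f| ≤ a * b / 4 := by
  obtain ⟨x₀⟩ := ‹Nonempty ι›
  have hderiv_le (t : ℝ) := abs_gibbsAverage_mul_sub_le (fun x => v x + t * (u x - v x))
    ((abs_nonneg _).trans (hf x₀ x₀)) ((abs_nonneg _).trans (huv x₀ x₀)) hf huv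
  have hmvt := norm_image_sub_le_of_norm_deriv_le_segment_01'
    (fun t _ => (hasDerivAt_gibbsAverage v (fun x => u x - v x) f t).hasDerivWithinAt)
    fun t _ => hderiv_le t
  simpa using hmvt

theorem enorm_gibbsAverage_sub_gibbsAverage_le {a b : ℝ≥0∞} (hf : ∀ x y, ‖f x - f y‖ₑ ≤ a)
    (huv : ∀ x y, ‖(u x - v x) - (u y - v y)‖ₑ ≤ b) :
    ‖gibbsAverage u f - gibbsAverage v f‖ₑ ≤ a * b / 4 := by
  obtain ⟨⟨x, y⟩, hxy⟩ := Finite.exists_max fun z : ι × ι => |f z.1 - f z.2|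
  obtain ⟨⟨x', y'⟩, hxy'⟩ :=
    Finite.exists_max fun z : ι × ι => |(u z.1 - v z.1) - (u z.2 - v z.2)|
  have hreal := abs_gibbsAverage_sub_gibbsAverage_le (fun x y => hxy (x, y))
    fun x y => hxy' (x, y)
  calc ‖gibbsAverage u f - gibbsAverage v f‖ₑ
      ≤ ‖(f x - f y) * ((u x' - v x') - (u y' - v y')) / 4‖ₑ := by
        rw [enorm_le_iff_norm_le]
        simpa [abs_div, abs_mul] using hreal
    _ = ‖f x - f y‖ₑ * ‖(u x' - v x') - (u y' - v y')‖ₑ / 4 := by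
        rw [div_eq_mul_inv, enorm_mul, enorm_mul, enorm_inv four_ne_zero, ← div_eq_mul_inv,
          Real.enorm_of_nonneg zero_le_four, ENNReal.ofReal_ofNat]
    _ ≤ a * b / 4 := by gcongr; exacts [hf x y, huv x' y']

theorem enorm_gibbsAverage_sub_le (u : ι → ℝ) {a : ℝ≥0∞} (hfg : ∀ x, ‖f x - g x‖ₑ ≤ a) :
    ‖gibbsAverage u f - gibbsAverage u g‖ₑ ≤ a := by
  obtain ⟨x, hx⟩ := Finite.exists_max fun x => |f x - g x|
  refine le_trans (enorm_le_iff_norm_le.2 ?_) (hfg x)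
  rw [gibbsAverage, gibbsAverage, ← sub_div, ← Finset.sum_sub_distrib, norm_div,
    Real.norm_of_nonneg (sum_exp_pos u).le, div_le_iff₀ (sum_exp_pos u), Finset.mul_sum]
  refine norm_sum_le_of_le _ fun y _ => ?_
  rw [← mul_sub, norm_mul, Real.norm_of_nonneg (Real.exp_pos _).le, mul_comm]
  exact mul_le_mul_of_nonneg_right (hx y) (Real.exp_pos _).le

end GibbsAverage

section Influence

variable {L E : Type*} {Φ : LatticeInteraction L E} {i j : L}

theorem hamiltonian_singleton (Φ : LatticeInteraction L E) (i : L) (ω : L → E) :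
    Φ.hamiltonian {i} ω = ∑' V : {V : Finset L // i ∈ V}, Φ V ω :=
  (Equiv.subtypeEquivRight fun _ => by simp).tsum_eq fun V : {V : Finset L // i ∈ V} => Φ V ω

variable [DecidableEq L]

/-- Dobrushin's bound `(1/2) ∑_{V ∋ i, j} δ(Φ_V)` for the influence of the spin at `j` on the
conditional distribution of the spin at `i ≠ j`; it is zero for `j = i`. -/
def influence (Φ : LatticeInteraction L E) (i j : L) : ℝ≥0∞ :=
  (1 / 2) * ∑' V : {V : Finset L // i ∈ V},
    if j ∈ (V : Finset L).erase i then variation (Φ V) else 0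

theorem tsum_influence_le (Φ : LatticeInteraction L E) (i : L) :
    ∑' j, influence Φ i j ≤ Φ.dobrushinConst := by
  have hbond (V : {V : Finset L // i ∈ V}) :
      ∑' j, (if j ∈ (V : Finset L).erase i then variation (Φ V) else 0)
        = (((V : Finset L).card : ℝ≥0∞) - 1) * variation (Φ V) := by
    rw [tsum_eq_sum fun j hj => if_neg hj, Finset.sum_ite_mem, Finset.inter_self,
      Finset.sum_const, nsmul_eq_mul, Finset.card_erase_of_mem V.2, ENNReal.natCast_sub,
      Nat.cast_one]
  simp only [influence, ENNReal.tsum_mul_left]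
  rw [ENNReal.tsum_comm]
  simp only [hbond]
  exact mul_le_mul_right (le_iSup (fun i : L => ∑' V : {V : Finset L // i ∈ V},
    (((V : Finset L).card : ℝ≥0∞) - 1) * variation (Φ V)) i) _

theorem IsUAC.enorm_hamiltonian_singleton_sub_le (h : Φ.IsUAC) (hij : j ≠ i) {σ τ : L → E}
    (hστ : ∀ k, k ≠ j → σ k = τ k) :
    ‖Φ.hamiltonian {i} σ - Φ.hamiltonian {i} τ‖ₑ ≤ 2 * influence Φ i j := by
  have hsummable (ω : L → E) : Summable fun V : {V : Finset L // i ∈ V} => Φ V ω :=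
    (Equiv.subtypeEquivRight fun _ => by simp).summable_iff.1 (h.summable {i} ω)
  rw [hamiltonian_singleton, hamiltonian_singleton, ← (hsummable σ).tsum_sub (hsummable τ),
    influence, ← mul_assoc, one_div, ENNReal.mul_inv_cancel two_ne_zero ENNReal.ofNat_ne_top,
    one_mul]
  refine enorm_tsum_le_tsum_enorm.trans (ENNReal.tsum_le_tsum fun V => ?_)
  split_ifs with hj
  · exact enorm_sub_le_variation (Φ V) σ τ
  · have : Φ V σ = Φ V τ := Φ.dependsOn_toFun V fun k hk =>
      hστ k fun hkj => hj (Finset.mem_erase.2 ⟨hij, hkj ▸ hk⟩)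
    simp [this]

end Influence

section SiteOscillation

variable {L E : Type*} {f : (L → E) → ℝ}

/-- The oscillation of `f` at the site `j`: the supremum of `|f σ - f τ|` over configurations
`σ`, `τ` differing at most at `j`. -/
def siteOsc (f : (L → E) → ℝ) (j : L) : ℝ≥0∞ :=
  ⨆ (σ) (τ) (_ : ∀ k, k ≠ j → σ k = τ k), ‖f σ - f τ‖ₑ

theorem enorm_sub_le_siteOsc (f : (L → E) → ℝ) {j : L} {σ τ : L → E}
    (h : ∀ k, k ≠ j → σ k = τ k) : ‖f σ - f τ‖ₑ ≤ siteOsc f j :=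
  le_iSup₂_of_le σ τ (le_iSup_of_le h le_rfl)

theorem siteOsc_le_variation (f : (L → E) → ℝ) (j : L) : siteOsc f j ≤ variation f :=
  iSup₂_le fun σ τ => iSup_le fun _ => enorm_sub_le_variation f σ τ

theorem siteOsc_eq_zero_of_dependsOn {s : Set L} (hf : DependsOn f s) {j : L} (hj : j ∉ s) :
    siteOsc f j = 0 :=
  nonpos_iff_eq_zero.1 <| iSup₂_le fun σ τ => iSup_le fun h => by
    rw [hf fun k hk => h k (ne_of_mem_of_not_mem hk hj), sub_self, enorm_zero]

theorem tsum_siteOsc_ne_top_of_dependsOn [TopologicalSpace E] [Finite E] (hf : Continuous f)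
    {s : Finset L} (hs : DependsOn f (s : Set L)) : ∑' j, siteOsc f j ≠ ∞ := by
  rw [tsum_eq_sum fun j hj => siteOsc_eq_zero_of_dependsOn hs hj]
  refine ENNReal.sum_ne_top.2 fun j _ => ne_top_of_le_ne_top ?_
    ((siteOsc_le_variation f j).trans (variation_le_two_mul_supNorm f))
  exact ENNReal.mul_ne_top ENNReal.ofNat_ne_top (supNorm_ne_top_of_continuous hf)

theorem enorm_piecewise_sub_le_sum_siteOsc [DecidableEq L] (f : (L → E) → ℝ) (s : Finset L)
    (σ τ : L → E) :
    ‖f (s.piecewise σ τ) - f τ‖ₑ ≤ ∑ j ∈ s, siteOsc f j := by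
  induction s using Finset.induction_on with
  | empty => simp
  | insert j s hj ih =>
    rw [Finset.sum_insert hj, ← sub_add_sub_cancel _ (f (s.piecewise σ τ)),
      Finset.piecewise_insert]
    exact (enorm_add_le _ _).trans
      (add_le_add (enorm_sub_le_siteOsc f fun k hk => Function.update_of_ne hk _ _) ih)

theorem enorm_sub_le_tsum_siteOsc [TopologicalSpace E] (hf : Continuous f) (σ τ : L → E) :
    ‖f σ - f τ‖ₑ ≤ ∑' j, siteOsc f j := by
  classical
  have hpiecewise : Tendsto (fun s : Finset L => s.piecewise σ τ) atTop (𝓝 σ) :=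
    tendsto_pi_nhds.2 fun j => tendsto_const_nhds.congr' <|
      (eventually_ge_atTop {j}).mono fun s hs =>
        (Finset.piecewise_eq_of_mem s σ τ (Finset.singleton_subset_iff.1 hs)).symm
  exact le_of_tendsto (((hf.tendsto σ).comp hpiecewise).sub_const (f τ)).enorm <|
    .of_forall fun s => (enorm_piecewise_sub_le_sum_siteOsc f s σ τ).trans (ENNReal.sum_le_tsum s)

end SiteOscillation

section SingleSite

variable {L E : Type*} [DecidableEq L] [Fintype E] {Φ : LatticeInteraction L E}

theorem specAverage_eq_gibbsAverage (Φ : LatticeInteraction L E) (Λ : Finset L)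
    (f : (L → E) → ℝ) (σ : L → E) : Φ.specAverage Λ f σ
      = gibbsAverage (fun ξ => -Φ.hamiltonian Λ (Function.updateFinset σ Λ ξ))
          (fun ξ => f (Function.updateFinset σ Λ ξ)) :=
  specAverage_eq_div Φ Λ f σ

theorem siteOsc_specAverage_self (Φ : LatticeInteraction L E) (i : L) (f : (L → E) → ℝ) :
    siteOsc (Φ.specAverage {i} f) i = 0 :=
  siteOsc_eq_zero_of_dependsOn (Φ.dependsOn_specAverage {i} f) (by simp)

theorem IsUAC.siteOsc_specAverage_le [Nonempty E] (h : Φ.IsUAC) {i j : L} (hij : j ≠ i)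
    (f : (L → E) → ℝ) :
    siteOsc (Φ.specAverage {i} f) j ≤ siteOsc f j + influence Φ i j * siteOsc f i := by
  refine iSup₂_le fun σ τ => iSup_le fun hστ => ?_
  let glue (ω : L → E) (ξ : ({i} : Finset L) → E) : L → E := Function.updateFinset ω {i} ξ
  let u (ω : L → E) (ξ : ({i} : Finset L) → E) : ℝ := -Φ.hamiltonian {i} (glue ω ξ)
  let F (ω : L → E) (ξ : ({i} : Finset L) → E) : ℝ := f (glue ω ξ)
  have glue_agree (ξ) (k : L) (hk : k ≠ j) : glue σ ξ k = glue τ ξ k := by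
    simp only [glue, Function.updateFinset, hστ k hk]
  have hF (ξ ζ) : ‖F σ ξ - F σ ζ‖ₑ ≤ siteOsc f i := enorm_sub_le_siteOsc f fun k hk => by
    simp [glue, Function.updateFinset, hk]
  have hu (ξ ζ) : ‖(u σ ξ - u τ ξ) - (u σ ζ - u τ ζ)‖ₑ ≤ 4 * influence Φ i j := by
    have hle (ξ) : ‖u σ ξ - u τ ξ‖ₑ ≤ 2 * influence Φ i j := by
      rw [neg_sub_neg, enorm_sub_rev]
      exact h.enorm_hamiltonian_singleton_sub_le hij (glue_agree ξ)
    calc ‖(u σ ξ - u τ ξ) - (u σ ζ - u τ ζ)‖ₑ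
        ≤ 2 * influence Φ i j + 2 * influence Φ i j :=
          enorm_sub_le.trans (add_le_add (hle ξ) (hle ζ))
      _ = 4 * influence Φ i j := by ring
  calc ‖Φ.specAverage {i} f σ - Φ.specAverage {i} f τ‖ₑ
      = ‖(gibbsAverage (u τ) (F σ) - gibbsAverage (u τ) (F τ))
          + (gibbsAverage (u σ) (F σ) - gibbsAverage (u τ) (F σ))‖ₑ := by
        rw [specAverage_eq_gibbsAverage, specAverage_eq_gibbsAverage, add_comm,
          sub_add_sub_cancel]
    _ ≤ siteOsc f j + siteOsc f i * (4 * influence Φ i j) / 4 :=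
        (enorm_add_le _ _).trans <| add_le_add
          (enorm_gibbsAverage_sub_le _ fun ξ => enorm_sub_le_siteOsc f (glue_agree ξ))
          (enorm_gibbsAverage_sub_gibbsAverage_le hF hu)
    _ = siteOsc f j + influence Φ i j * siteOsc f i := by
        rw [mul_left_comm, mul_div_assoc, ENNReal.mul_div_cancel four_ne_zero
          ENNReal.ofNat_ne_top, mul_comm]

end SingleSite

section Comparison

variable {L E : Type*} [TopologicalSpace E] [MeasurableSpace E] {μ ν : Measure (L → E)}

/-- The weights `w` control how far apart the measures `μ` and `ν` are, in terms of the
oscillations of the test functions at the sites. -/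
def IsComparisonWeight (μ ν : Measure (L → E)) (w : L → ℝ≥0∞) : Prop :=
  ∀ f : (L → E) → ℝ, Continuous f → ‖∫ σ, f σ ∂μ - ∫ σ, f σ ∂ν‖ₑ ≤ ∑' j, w j * siteOsc f j

theorem enorm_integral_sub_le {X : Type*} [MeasurableSpace X] {ρ : Measure X}
    [IsProbabilityMeasure ρ] {f : X → ℝ} (hf : Integrable f ρ) {c : ℝ} {C : ℝ≥0∞}
    (hC : ∀ x, ‖f x - c‖ₑ ≤ C) : ‖∫ x, f x ∂ρ - c‖ₑ ≤ C :=
  calc ‖∫ x, f x ∂ρ - c‖ₑ = ‖∫ x, (f x - c) ∂ρ‖ₑ := by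
        rw [integral_sub hf (integrable_const c), integral_const, probReal_univ, one_smul]
    _ ≤ ∫⁻ x, ‖f x - c‖ₑ ∂ρ := enorm_integral_le_lintegral_enorm _
    _ ≤ ∫⁻ _, C ∂ρ := lintegral_mono hC
    _ = C := by rw [lintegral_const, measure_univ, mul_one]

theorem isComparisonWeight_one [Countable L] [CompactSpace E] [SecondCountableTopology E]
    [OpensMeasurableSpace E] [IsProbabilityMeasure μ] [IsProbabilityMeasure ν] :
    IsComparisonWeight μ ν fun _ => 1 := fun f hf => by
  simp only [one_mul]
  refine enorm_integral_sub_le (integrable_of_continuous hf μ) fun σ => ?_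
  rw [enorm_sub_rev]
  exact enorm_integral_sub_le (integrable_of_continuous hf ν) fun τ =>
    enorm_sub_le_tsum_siteOsc hf τ σ

theorem tsum_piecewise_mul_le {ι : Type*} [DecidableEq ι] (s : Finset ι) (a b : ℝ≥0∞)
    (x : ι → ℝ≥0∞) : ∑' j, s.piecewise (fun _ => a) (fun _ => b) j * x j
      ≤ a * ∑' j, x j + b * ∑' j : {j // j ∉ s}, x j := by
  have htail : ∑' j : {j // j ∉ s}, x j = ∑' j, Set.indicator {j | j ∉ s} x j :=
    tsum_subtype {j | j ∉ s} x
  rw [htail, ← ENNReal.tsum_mul_left, ← ENNReal.tsum_mul_left, ← ENNReal.tsum_add]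
  refine ENNReal.tsum_le_tsum fun j => ?_
  by_cases hj : j ∈ s <;> simp [hj]

end Comparison

section Uniqueness

variable {L E : Type*} [DecidableEq L] [Countable L] [Fintype E] [Nonempty E]
  [TopologicalSpace E] [DiscreteTopology E] [MeasurableSpace E] [BorelSpace E]
  {Φ : LatticeInteraction L E} {μ ν : Measure (L → E)} {w : L → ℝ≥0∞} {a r : ℝ≥0∞}

theorem IsComparisonWeight.update (hw : IsComparisonWeight μ ν w) (h : Φ.IsUAC)
    (hμ : μ ∈ Φ.gibbsMeasures) (hν : ν ∈ Φ.gibbsMeasures) (hr : Φ.dobrushinConst ≤ r)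
    (hwa : ∀ j, w j ≤ a) (i : L) :
    IsComparisonWeight μ ν (Function.update w i (r * a)) := fun f hf => by
  have := hμ.1
  have := hν.1
  have hsite (j : L) : w j * siteOsc (Φ.specAverage {i} f) j
      ≤ (if j = i then 0 else w j * siteOsc f j) + a * siteOsc f i * influence Φ i j := by
    split_ifs with hij
    · simp [hij, siteOsc_specAverage_self]
    · calc w j * siteOsc (Φ.specAverage {i} f) j
          ≤ w j * (siteOsc f j + influence Φ i j * siteOsc f i) := by
            gcongr
            exact h.siteOsc_specAverage_le hij f
        _ ≤ w j * siteOsc f j + a * (influence Φ i j * siteOsc f i) := by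
            rw [mul_add]
            gcongr
            exact hwa j
        _ = w j * siteOsc f j + a * siteOsc f i * influence Φ i j := by ring
  rw [← (hμ.2 {i} f (integrable_of_continuous hf μ)).2,
    ← (hν.2 {i} f (integrable_of_continuous hf ν)).2]
  calc ‖∫ σ, Φ.specAverage {i} f σ ∂μ - ∫ σ, Φ.specAverage {i} f σ ∂ν‖ₑ
      ≤ ∑' j, w j * siteOsc (Φ.specAverage {i} f) j := hw _ (h.continuous_specAverage {i} hf)
    _ ≤ (∑' j, if j = i then 0 else w j * siteOsc f j)
          + a * siteOsc f i * ∑' j, influence Φ i j := by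
        rw [← ENNReal.tsum_mul_left, ← ENNReal.tsum_add]
        exact ENNReal.tsum_le_tsum hsite
    _ ≤ (∑' j, if j = i then 0 else w j * siteOsc f j) + a * siteOsc f i * r := by
        gcongr
        exact (tsum_influence_le Φ i).trans hr
    _ = ∑' j, Function.update w i (r * a) j * siteOsc f j := by
        rw [ENNReal.tsum_eq_add_tsum_ite (f := fun j => Function.update w i _ j * _) i,
          Function.update_self, add_comm, mul_right_comm,
          mul_comm a r]
        congr 1
        refine tsum_congr fun j => ?_
        split_ifs with hij
        · rfl
        · rw [Function.update_of_ne hij]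

theorem IsComparisonWeight.piecewise (ha : IsComparisonWeight μ ν fun _ => a) (h : Φ.IsUAC)
    (hμ : μ ∈ Φ.gibbsMeasures) (hν : ν ∈ Φ.gibbsMeasures) (hr : Φ.dobrushinConst ≤ r)
    (hr1 : r ≤ 1) (s : Finset L) :
    IsComparisonWeight μ ν (s.piecewise (fun _ => r * a) fun _ => a) := by
  induction s using Finset.induction_on with
  | empty => simpa using ha
  | insert i s _ ih =>
    rw [Finset.piecewise_insert]
    exact ih.update h hμ hν hr (fun j => s.piecewise_le_of_le_of_le
      (fun _ => mul_le_of_le_one_left' hr1) le_rfl j) i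

theorem IsComparisonWeight.mul_const (ha : IsComparisonWeight μ ν fun _ => a) (h : Φ.IsUAC)
    (hμ : μ ∈ Φ.gibbsMeasures) (hν : ν ∈ Φ.gibbsMeasures) (hr : Φ.dobrushinConst ≤ r)
    (hr1 : r ≤ 1) (hr0 : r ≠ 0) (ha0 : a ≠ 0) (ha_top : a ≠ ∞) :
    IsComparisonWeight μ ν fun _ => r * a := fun f hf => by
  rw [ENNReal.tsum_mul_left]
  by_cases hosc : ∑' j, siteOsc f j = ∞
  · simp [hosc, ENNReal.mul_top, hr0, ha0]
  have htail : Tendsto (fun s : Finset L => r * a * ∑' j, siteOsc f j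
      + a * ∑' j : {j // j ∉ s}, siteOsc f j) atTop (𝓝 (r * a * ∑' j, siteOsc f j + a * 0)) :=
    tendsto_const_nhds.add <|
      ENNReal.Tendsto.const_mul (ENNReal.tendsto_tsum_compl_atTop_zero hosc) (.inr ha_top)
  rw [mul_zero, add_zero] at htail
  refine ge_of_tendsto htail (.of_forall fun s => ?_)
  refine (ha.piecewise h hμ hν hr hr1 s f hf).trans ?_
  exact tsum_piecewise_mul_le s (r * a) a (siteOsc f)

theorem isComparisonWeight_pow (h : Φ.IsUAC) (hμ : μ ∈ Φ.gibbsMeasures)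
    (hν : ν ∈ Φ.gibbsMeasures) (hr : Φ.dobrushinConst ≤ r) (hr1 : r ≤ 1) (hr0 : r ≠ 0) (n : ℕ) :
    IsComparisonWeight μ ν fun _ => r ^ n := by
  have := hμ.1
  have := hν.1
  induction n with
  | zero => simpa using isComparisonWeight_one
  | succ n ih =>
    simpa only [pow_succ'] using ih.mul_const h hμ hν hr hr1 hr0 (pow_ne_zero n hr0)
      (ENNReal.pow_ne_top (ne_top_of_le_ne_top ENNReal.one_ne_top hr1))

theorem IsUAC.integral_eq_of_dependsOn (h : Φ.IsUAC) (hc : Φ.DobrushinCriterion)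
    (hμ : μ ∈ Φ.gibbsMeasures) (hν : ν ∈ Φ.gibbsMeasures) {f : (L → E) → ℝ}
    (hf : Continuous f) {s : Finset L} (hs : DependsOn f (s : Set L)) :
    ∫ σ, f σ ∂μ = ∫ σ, f σ ∂ν := by
  obtain ⟨r, hcr, hr1⟩ := exists_between hc
  have hbound (n : ℕ) : ‖∫ σ, f σ ∂μ - ∫ σ, f σ ∂ν‖ₑ ≤ r ^ n * ∑' j, siteOsc f j := by
    rw [← ENNReal.tsum_mul_left]
    exact isComparisonWeight_pow h hμ hν hcr.le hr1.le hcr.ne_bot n f hf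
  have hlim : Tendsto (fun n => r ^ n * ∑' j, siteOsc f j) atTop (𝓝 0) := by
    simpa using ENNReal.Tendsto.mul_const (ENNReal.tendsto_pow_atTop_nhds_zero_of_lt_one hr1)
      (.inr (tsum_siteOsc_ne_top_of_dependsOn hf hs))
  exact sub_eq_zero.1 (enorm_eq_zero.1 (nonpos_iff_eq_zero.1 (ge_of_tendsto' hlim hbound)))

theorem IsUAC.gibbsMeasures_subsingleton (h : Φ.IsUAC) (hc : Φ.DobrushinCriterion) :
    Φ.gibbsMeasures.Subsingleton := fun μ hμ ν hν => by
  have := hμ.1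
  have := hν.1
  have map_restrict (s : Finset L) : μ.map s.restrict = ν.map s.restrict :=
    have hmeas : Measurable (s.restrict : (L → E) → s → E) := Finset.measurable_restrict s
    ext_of_forall_integral_eq_of_IsFiniteMeasure fun g => by
      rw [integral_map hmeas.aemeasurable g.continuous.aestronglyMeasurable,
        integral_map hmeas.aemeasurable g.continuous.aestronglyMeasurable]
      exact h.integral_eq_of_dependsOn hc hμ hν
        (g.continuous.comp (Finset.continuous_restrict s)) fun σ τ hστ =>
          congrArg g (funext fun j => hστ j j.2)
  exact IsProjectiveLimit.unique (P := fun s => ν.map s.restrict) map_restrict fun _ => rfl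

theorem IsUAC.exists_gibbsMeasures_eq_singleton (h : Φ.IsUAC) (hc : Φ.DobrushinCriterion) :
    ∃ ν, Φ.gibbsMeasures = {ν} :=
  Set.exists_eq_singleton_iff_nonempty_subsingleton.2
    ⟨h.gibbsMeasures_nonempty, h.gibbsMeasures_subsingleton hc⟩

end Uniqueness

section Perturbation

variable {L E : Type*} {Φ Ψ P : LatticeInteraction L E} {Λ : ℕ → Finset L}

theorem IsUAC.isTotalEnergy_deleteBonds_image_compl [DecidableEq L] (h : Φ.IsUAC)
    {s : Finset ℕ} (hΛ : Set.InjOn Λ s) :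
    (Φ.deleteBonds ((s.image Λ : Finset (Finset L)) : Set (Finset L))ᶜ).IsTotalEnergy
      fun ω => ∑ i ∈ s, Φ (Λ i) ω := by
  simpa only [Finset.sum_image hΛ] using h.isTotalEnergy_deleteBonds_compl (s.image Λ)

theorem deleteBonds_image_Ici_add_deleteBonds_compl [DecidableEq L]
    (hΛ : Set.InjOn Λ (Set.Ici 1)) (k : ℕ) :
    Φ.deleteBonds (Λ '' Set.Ici 1)
        + Φ.deleteBonds (((Finset.Icc 1 k).image Λ : Finset (Finset L)) : Set (Finset L))ᶜ
      = Φ.deleteBonds (Λ '' Set.Ici (k + 1)) := by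
  have hunion : Set.Ici 1 = Set.Ici (k + 1) ∪ Set.Icc 1 k := by
    ext i
    simp only [Set.mem_Ici, Set.mem_union, Set.mem_Icc]
    lia
  have hdisj : Disjoint (Λ '' Set.Ici (k + 1)) (Λ '' Set.Icc 1 k) :=
    Set.disjoint_image_image fun i hi j hj hij => (Nat.lt_of_succ_le hi).not_ge <|
      hΛ (Nat.le_of_add_left_le hi) hj.1 hij ▸ hj.2
  rw [Finset.coe_image, Finset.coe_Icc, hunion, Set.image_union]
  exact deleteBonds_union_add_deleteBonds_compl hdisj

theorem absolutelyContinuous_and_rnDeriv_of_gibbsMeasures_eq_singleton [DecidableEq L]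
    [Countable L] [Fintype E] [Nonempty E] [TopologicalSpace E] [DiscreteTopology E]
    [MeasurableSpace E] [BorelSpace E] (hΨ : Ψ.IsUAC) (hP : P.IsUAC) {h : (L → E) → ℝ}
    (hcont : Continuous h) (hh : P.IsTotalEnergy h) {ν ν' : Measure (L → E)}
    (hν : Ψ.gibbsMeasures = {ν}) (hν' : ν' ∈ (Ψ + P).gibbsMeasures) :
    ν' ≪ ν ∧ ν ≪ ν' ∧
      ν'.rnDeriv ν =ᵐ[ν] (fun ω => ENNReal.ofReal
        (Real.exp (-h ω) / ∫ σ, Real.exp (-h σ) ∂ν)) ∧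
      ν.rnDeriv ν' =ᵐ[ν'] (fun ω => ENNReal.ofReal
        (Real.exp (h ω) / ∫ σ, Real.exp (h σ) ∂ν')) := by
  have : IsProbabilityMeasure ν' := hν'.1
  have : IsProbabilityMeasure ν := (hν ▸ Set.mem_singleton ν : ν ∈ Ψ.gibbsMeasures).1
  obtain ⟨hν_eq, hν'_eq⟩ := eq_tilted_of_gibbsMeasures_eq_singleton hΨ hP hcont hh hν hν'
  have hrn : (ν.tilted (-h)).rnDeriv ν =ᵐ[ν] _ :=
    rnDeriv_tilted_left_self hcont.neg.measurable.aemeasurable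
  have hrn' : (ν'.tilted h).rnDeriv ν' =ᵐ[ν'] _ :=
    rnDeriv_tilted_left_self hcont.measurable.aemeasurable
  rw [← hν'_eq] at hrn
  rw [← hν_eq] at hrn'
  exact ⟨hν'_eq ▸ tilted_absolutelyContinuous ν (-h), hν_eq ▸ tilted_absolutelyContinuous ν' h,
    hrn, hrn'⟩

end Perturbation

end LatticeInteraction

theorem mainTheorem7_general {L E : Type*} [Countable L] [DecidableEq L] [Fintype E]
    [Nonempty E] [MeasurableSpace E] [DiscreteMeasurableSpace E] :
    (∀ (Φ : LatticeInteraction L E) (Λ : ℕ → Finset L),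
      Φ.IsUAC → Φ.DobrushinCriterion → Set.InjOn Λ (Set.Ici 1) →
      (∀ k : ℕ, (Φ.deleteBonds (Λ '' Set.Ici (k + 1))).DobrushinCriterion) ∧
      ∃ ν : ℕ → Measure (L → E),
        (∀ k : ℕ, (Φ.deleteBonds (Λ '' Set.Ici (k + 1))).gibbsMeasures = {ν k}) ∧
        ∀ k : ℕ, ν k ≪ ν 0 ∧ ν 0 ≪ ν k ∧
          (ν k).rnDeriv (ν 0) =ᵐ[ν 0] (fun ω => ENNReal.ofReal
            (Real.exp (-∑ i ∈ Finset.Icc 1 k, Φ (Λ i) ω) /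
              ∫ σ, Real.exp (-∑ i ∈ Finset.Icc 1 k, Φ (Λ i) σ) ∂(ν 0))) ∧
          (ν 0).rnDeriv (ν k) =ᵐ[ν k] (fun ω => ENNReal.ofReal
            (Real.exp (∑ i ∈ Finset.Icc 1 k, Φ (Λ i) ω) /
              ∫ σ, Real.exp (∑ i ∈ Finset.Icc 1 k, Φ (Λ i) σ) ∂(ν k)))) ∧
    (∀ (Ψ P : LatticeInteraction L E) (A : Finset L) (ν ν' : Measure (L → E)),
      Ψ.IsUAC → P.IsUAC → (∀ V : Finset L, V.Nonempty → Disjoint V A → ∀ ω, P V ω = 0) →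
      Ψ.gibbsMeasures = {ν} → ν' ∈ (Ψ + P).gibbsMeasures →
      ν' ≪ ν ∧
      ν'.rnDeriv ν =ᵐ[ν] (fun ω => ENNReal.ofReal
        (Real.exp (-P.hamiltonian A ω) / ∫ σ, Real.exp (-P.hamiltonian A σ) ∂ν))) := by
  let : TopologicalSpace E := ⊥
  have : DiscreteTopology E := ⟨rfl⟩
  refine ⟨fun Φ Λ hΦ hc hΛ => ⟨fun _ => hc.deleteBonds _, ?_⟩,
    fun Ψ P A ν ν' hΨ hP hA hν hν' => ?_⟩
  · choose ν hν using fun k : ℕ =>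
      (hΦ.deleteBonds (Λ '' Set.Ici (k + 1))).exists_gibbsMeasures_eq_singleton (hc.deleteBonds _)
    refine ⟨ν, hν, fun k => ?_⟩
    refine LatticeInteraction.absolutelyContinuous_and_rnDeriv_of_gibbsMeasures_eq_singleton
      (hΦ.deleteBonds _) (hΦ.deleteBonds _) (continuous_finsetSum _ fun i _ =>
        Φ.continuous_toFun (Λ i)) (hΦ.isTotalEnergy_deleteBonds_image_compl
        (hΛ.mono fun i hi => (Finset.mem_Icc.1 hi).1)) (hν 0) ?_
    rw [zero_add, LatticeInteraction.deleteBonds_image_Ici_add_deleteBonds_compl hΛ, hν k]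
    exact Set.mem_singleton _
  · obtain ⟨hac, -, hrn, -⟩ :=
      LatticeInteraction.absolutelyContinuous_and_rnDeriv_of_gibbsMeasures_eq_singleton hΨ hP
        (hP.continuous_hamiltonian A) (hP.isTotalEnergy_hamiltonian hA) hν hν'
    exact ⟨hac, hrn⟩

end

theorem mainTheorem7 {E : Type*} [Fintype E] [Nonempty E] [MeasurableSpace E]
    [DiscreteMeasurableSpace E] :
    -- the intermediate interactions; `Λ 1, Λ 2, …` is an enumeration of the cross-origin bonds
    (∀ (Φ : LatticeInteraction ℤ E) (Λ : ℕ → Finset ℤ),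
      Φ.IsUAC → Φ.DobrushinCriterion → Set.BijOn Λ (Set.Ici 1) crossOriginBonds →
      (∀ k : ℕ, (intermediateInteraction Φ Λ k).DobrushinCriterion) ∧
      ∃ ν : ℕ → Measure (ℤ → E),
        (∀ k : ℕ, (intermediateInteraction Φ Λ k).gibbsMeasures = {ν k}) ∧
        ∀ k : ℕ, ν k ≪ ν 0 ∧ ν 0 ≪ ν k ∧
          (ν k).rnDeriv (ν 0) =ᵐ[ν 0] (fun ω => ENNReal.ofReal
            (Real.exp (-∑ i ∈ Finset.Icc 1 k, Φ (Λ i) ω) /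
              ∫ σ, Real.exp (-∑ i ∈ Finset.Icc 1 k, Φ (Λ i) σ) ∂(ν 0))) ∧
          (ν 0).rnDeriv (ν k) =ᵐ[ν k] (fun ω => ENNReal.ofReal
            (Real.exp (∑ i ∈ Finset.Icc 1 k, Φ (Λ i) ω) /
              ∫ σ, Real.exp (∑ i ∈ Finset.Icc 1 k, Φ (Λ i) σ) ∂(ν k)))) ∧
    -- the lemma on finite perturbations `P` supported on a finite set `A`
    (∀ (Ψ P : LatticeInteraction ℤ E) (A : Finset ℤ) (ν ν' : Measure (ℤ → E)),
      Ψ.IsUAC → (∀ V : Finset ℤ, ¬ V ⊆ A → ∀ ω, P V ω = 0) →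
      Ψ.gibbsMeasures = {ν} → ν' ∈ (Ψ + P).gibbsMeasures →
      ν' ≪ ν ∧
      ν'.rnDeriv ν =ᵐ[ν] (fun ω => ENNReal.ofReal
        (Real.exp (-P.hamiltonian A ω) / ∫ σ, Real.exp (-P.hamiltonian A σ) ∂ν))) := by
  refine ⟨fun Φ Λ hΦ hc hΛ => mainTheorem7_general.1 Φ Λ hΦ hc hΛ.injOn,
    fun Ψ P A ν ν' hΨ hPA => mainTheorem7_general.2 Ψ P A ν ν' hΨ
      (LatticeInteraction.isUAC_of_eq_zero_of_not_subset hPA) fun V hV hVA =>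
        hPA V fun hsub => hV.ne_empty (hVA.eq_bot_of_le hsub)⟩
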